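/- A rooted tree $\Gamma=(N,\le)$ is a nonempty finite poset with a unique minimal element $e_0$ (the root) in which $\{e'\in N : e'\le e\}$ is a chain for every $e\in N$. Write $\mathrm{Anc}(e)=\{e'\in N: e'<e\}$, let $\mathbf P(\Gamma)$ be the set of nodes that are not maximal, let $\mathrm{Child}(e)$ be the set of minimal elements of $\{e'\in N: e'>e\}$, and for $e\neq e_0$ let $\mathrm{Par}(e)$ be the greatest element of $\mathrm{Anc}(e)$. A fine-labelled rooted tree $\mathfrak g=(\Gamma,lb)$ is a rooted tree with a function $lb:N\setminus\{e_0\}\to\mathbb C$ such that $lb(f)\ne lb(f')$ whenever $f\neq f'$ and $\mathrm{Par}(f)=\mathrm{Par}(f')$. Let $A=\mathbb C[h]$, $Z=\mathrm{Spec}(A)\simeq\mathbb A^1_{\mathbb C}$, and let $A[\Gamma]=A[X_0][(X_e)_{e\in\mathbf P(\Gamma)}]$ be the polynomial ring, with the convention $X_{\mathrm{Par}(e_0)}=X_0$. For $e\in\mathbf P(\Gamma)$ and $J\subset\mathrm{Child}(e)$ put $S_e^J=\prod_{f\in\mathrm{Child}(e)\setminus J}(X_{\mathrm{Par}(e)}-lb(f))$;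 put $R_{e_0}=1$ and $R_e=S_{\mathrm{Par}(e)}^{\{e\}}R_{\mathrm{Par}(e)}$ for $e\ne e_0$; and put $Q_e=S_e^{\emptyset}R_e$ for $e\in\mathbf P(\Gamma)$. Let $M_0=\binom{h}{1}$ and $M_e=\binom{Q_e}{X_e}$. Let $I_{\mathfrak g}\subset A[\Gamma]$ be the ideal generated by the polynomials $\Delta_{0,e}=\det(M_0,M_e)$ for $e\in\mathbf P(\Gamma)$, and $\Delta_{e',e}=R_{e''}^{-1}\det(M_{e'},M_e)$ for $e\in\mathbf P(\Gamma)$ and $e'\in\mathrm{Anc}(e)$, where $e''$ is the unique child of $e'$ with $e''\le e$ (the division is exact in $A[\Gamma]$). Put $B_{\mathfrak g}=A[\Gamma]/I_{\mathfrak g}$ and $V_{\mathfrak g}=\mathrm{Spec}(B_{\mathfrak g})$, and let $q_{\mathfrak g}:V_{\mathfrak g}\to Z$ be the morphism induced by $A\to B_{\mathfrak g}$. **Corollary.** For every fine-labelled rooted tree $\mathfrak g$, the morphism $q_{\mathfrak g}:V_{\mathfrak g}\to Z$ is smooth, and $V_{\mathfrak g}$ is a nonsingular surface: it is an integral scheme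 of Krull dimension $2$, it is Noetherian, and all of its local rings are regular. -/

import Mathlib

open AlgebraicGeometry CategoryTheory

noncomputable section

namespace Danielewski

/-- A rooted tree: a nonempty finite poset with a unique minimal element (the root) in which the
elements below any given node form a chain. -/
structure FinRootedTree where
  Node : Type
  [partialOrder : PartialOrder Node]
  [fintype : Fintype Node]
  root : Node
  isMin_iff : ∀ e : Node, IsMin e ↔ e = root
  isChain_Iic : ∀ e : Node, IsChain (· ≤ ·) (Set.Iic e)

attribute [instance] FinRootedTree.partialOrder FinRootedTree.fintype

namespace FinRootedTree

variable (Γ : FinRootedTree)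

/-- The strict ancestors of a node. -/
def Anc (e : Γ.Node) : Set Γ.Node := Set.Iio e

/-- The parents of the tree: the nodes that are not leaves (a leaf is a maximal element). -/
abbrev P : Type := {e : Γ.Node // ¬ IsMax e}

open Classical in
/-- The children of `e`: the minimal elements among the nodes strictly above `e`. -/
def Child (e : Γ.Node) : Finset Γ.Node :=
  Finset.univ.filter fun f => Minimal (fun g => e < g) f

variable {Γ}

theorem mem_Child {e f : Γ.Node} : f ∈ Γ.Child e ↔ Minimal (fun g => e < g) f := by
  simp [Child]

theorem lt_of_mem_Child {e f : Γ.Node} (h : f ∈ Γ.Child e) : e < f :=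
  (mem_Child.1 h).prop

theorem ne_root_of_mem_Child {e f : Γ.Node} (h : f ∈ Γ.Child e) : f ≠ Γ.root := fun h' =>
  ((Γ.isMin_iff f).2 h').not_lt (lt_of_mem_Child h)

theorem exists_par {e : Γ.Node} (he : e ≠ Γ.root) : ∃ p, IsGreatest (Γ.Anc e) p := by
  have hne : (Γ.Anc e).Nonempty := by
    have h : ¬ IsMin e := fun h => he ((Γ.isMin_iff e).1 h)
    exact not_isMin_iff.1 h
  obtain ⟨p, hp⟩ := (Set.toFinite (Γ.Anc e)).exists_maximal hne
  refine ⟨p, hp.prop, fun q hq => ?_⟩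
  rcases (Γ.isChain_Iic e).total (le_of_lt hq) (le_of_lt hp.prop) with h | h
  · exact h
  · exact hp.le_of_ge hq h

/-- The parent of a node `e` different from the root: the greatest strict ancestor of `e`. -/
def par (e : Γ.Node) (he : e ≠ Γ.root) : Γ.Node := (exists_par he).choose

theorem par_spec (e : Γ.Node) (he : e ≠ Γ.root) : IsGreatest (Γ.Anc e) (par e he) :=
  (exists_par he).choose_spec

theorem par_lt (e : Γ.Node) (he : e ≠ Γ.root) : par e he < e := (par_spec e he).1

theorem par_not_isMax (e : Γ.Node) (he : e ≠ Γ.root) : ¬ IsMax (par e he) := fun h =>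
  h.not_lt (par_lt e he)

theorem mem_Child_par (e : Γ.Node) (he : e ≠ Γ.root) : e ∈ Γ.Child (par e he) := by
  refine mem_Child.2 ⟨par_lt e he, fun f hf hfe => ?_⟩
  rcases hfe.eq_or_lt with h | h
  · exact h.ge
  · exact absurd ((par_spec e he).2 h) (not_le_of_gt hf)

theorem par_eq_of_mem_Child {e f : Γ.Node} (h : f ∈ Γ.Child e) :
    par f (ne_root_of_mem_Child h) = e := by
  have hg := par_spec f (ne_root_of_mem_Child h)
  have hle : e ≤ par f (ne_root_of_mem_Child h) := hg.2 (lt_of_mem_Child h)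
  rcases hle.eq_or_lt with h' | h'
  · exact h'.symm
  · exact absurd ((mem_Child.1 h).le_of_le h' hg.1.le) (not_le_of_gt hg.1)

/-- For `e' < e` there is exactly one child of `e'` lying below `e`. -/
theorem existsUnique_childToward {e' e : Γ.Node} (h : e' < e) :
    ∃! f, f ∈ Γ.Child e' ∧ f ≤ e := by
  obtain ⟨f, hf⟩ := (Set.toFinite {g | e' < g ∧ g ≤ e}).exists_minimal ⟨e, h, le_rfl⟩
  have hmin : ∀ g, e' < g → g ≤ e → f ≤ g := fun g hg hge => by
    rcases (Γ.isChain_Iic e).total hf.prop.2 hge with h1 | h1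
    · exact h1
    · exact hf.le_of_le ⟨hg, hge⟩ h1
  refine ⟨f, ⟨mem_Child.2 ⟨hf.prop.1, fun g hg hgf => hmin g hg (hgf.trans hf.prop.2)⟩,
    hf.prop.2⟩, fun g hg => ?_⟩
  have h1 := hmin g (lt_of_mem_Child hg.1) hg.2
  exact le_antisymm ((mem_Child.1 hg.1).le_of_le hf.prop.1 h1) h1

/-- The unique element of `Child e' ∩ (↓ e)`, for an ancestor `e'` of `e`. -/
def childToward {e' e : Γ.Node} (h : e' < e) : Γ.Node := (existsUnique_childToward h).choose

theorem childToward_mem {e' e : Γ.Node} (h : e' < e) : childToward h ∈ Γ.Child e' :=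
  (existsUnique_childToward h).choose_spec.1.1

theorem childToward_le {e' e : Γ.Node} (h : e' < e) : childToward h ≤ e :=
  (existsUnique_childToward h).choose_spec.1.2

end FinRootedTree

/-- A labelled rooted tree: complex labels on all the nodes other than the root. -/
structure LabelledRootedTree extends FinRootedTree where
  lb : {e : Node // e ≠ root} → ℂ

/-- The base ring `A = ℂ[h]`; the variable `h` is `Polynomial.X`. -/
abbrev A : Type := Polynomial ℂ

namespace LabelledRootedTree

open FinRootedTree

variable (g : LabelledRootedTree)

/-- The labelling is fine: distinct nodes with the same parent have distinct labels. -/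
def IsFine : Prop :=
  ∀ f f' : {e : g.Node // e ≠ g.root},
    f ≠ f' → par (Γ := g.toFinRootedTree) f.1 f.2 = par f'.1 f'.2 → g.lb f ≠ g.lb f'

/-- The polynomial ring `A[Γ]` over `A = ℂ[h]`, in the variables `X₀` (index `none`) and `X_e`
(index `some e`) for the parents `e` of the tree. -/
abbrev AΓ : Type := MvPolynomial (Option g.P) A

/-- The variable `X₀`. -/
def X₀ : g.AΓ := MvPolynomial.X none

/-- The variable `X_e`. -/
def X (e : g.P) : g.AΓ := MvPolynomial.X (some e)

/-- The image of `h` in `A[Γ]`. -/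
def h : g.AΓ := MvPolynomial.C Polynomial.X

/-- The image in `A[Γ]` of the label of a node other than the root. -/
def label (e : g.Node) (he : e ≠ g.root) : g.AΓ :=
  MvPolynomial.C (Polynomial.C (g.lb ⟨e, he⟩))

open Classical in
/-- The variable `X_{Par(e)}`, which is `X₀` if `e` is the root. -/
def XPar (e : g.Node) : g.AΓ :=
  if he : e = g.root then g.X₀ else g.X ⟨par e he, par_not_isMax e he⟩

open Classical in
/-- The product `S_e^J` of `X_{Par(e)} - lb(f)` over the children `f` of `e` outside `J`. -/
def S (e : g.Node) (J : Finset g.Node) : g.AΓ :=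
  ∏ f ∈ (g.Child e).attach.filter (fun f => f.1 ∉ J),
    (g.XPar e - g.label f.1 (ne_root_of_mem_Child f.2))

open Classical in
/-- The root polynomial: `R_e = 1` at the root, and `R_e = S_{Par(e)}^{e} * R_{Par(e)}` at the
other nodes. -/
def R (e : g.Node) : g.AΓ :=
  if he : e = g.root then 1 else g.S (par e he) {e} * R (par e he)
termination_by wellFounded_lt.wrap e
decreasing_by exact par_lt e he

theorem R_root : g.R g.root = 1 := by rw [R]; simp

theorem R_of_ne_root {e : g.Node} (he : e ≠ g.root) :
    g.R e = g.S (par e he) {e} * g.R (par e he) := by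
  rw [R]; simp [he]

/-- The polynomial `Q_e = S_e * R_e`. -/
def Q (e : g.Node) : g.AΓ := g.S e ∅ * g.R e

/-- The matrix with the columns `M₀ = (h, 1)` and `M_e = (Q_e, X_e)`, for the parents `e`. -/
def M : Matrix (Fin 2) (Option g.P) g.AΓ :=
  Matrix.of fun i j => match j with
    | none => ![g.h, 1] i
    | some e => ![g.Q e.1, g.X e] i

/-- The `2 × 2` minor `det (M_j, M_k)`. -/
def minor (j k : Option g.P) : g.AΓ := (g.M.submatrix id ![j, k]).det

theorem R_dvd_R {f e : g.Node} (hfe : f ≤ e) : g.R f ∣ g.R e := by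
  induction e using WellFoundedLT.induction with
  | ind e ih =>
    rcases hfe.eq_or_lt with rfl | hlt
    · exact dvd_rfl
    · have he : e ≠ g.root := fun h => ((g.isMin_iff e).2 h).not_lt hlt
      rw [g.R_of_ne_root he]
      exact (ih _ (par_lt e he) ((par_spec e he).2 hlt)).mul_left _

theorem R_dvd_Q_of_mem_Child {e f : g.Node} (hf : f ∈ g.Child e) : g.R f ∣ g.Q e := by
  classical
  rw [g.R_of_ne_root (ne_root_of_mem_Child hf), Q, par_eq_of_mem_Child hf]
  refine mul_dvd_mul_right (Finset.prod_dvd_prod_of_subset _ _ _ fun x hx => ?_) _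
  simp_all

/-- The minor `det (M_{e'}, M_e)` is divisible by the root polynomial of the child of `e'` that
lies below `e`. -/
theorem R_dvd_minor {e' e : g.P} (hlt : e'.1 < e.1) :
    g.R (childToward hlt) ∣ g.minor (some e') (some e) := by
  have h1 : g.R (childToward hlt) ∣ g.Q e'.1 := g.R_dvd_Q_of_mem_Child (childToward_mem hlt)
  have h2 : g.R (childToward hlt) ∣ g.Q e.1 := (g.R_dvd_R (childToward_le hlt)).mul_left _
  have h3 : g.minor (some e') (some e) = g.Q e'.1 * g.X e - g.Q e.1 * g.X e' := by
    simp [minor, Matrix.det_fin_two, M]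
  rw [h3]
  exact (h1.mul_right _).sub (h2.mul_right _)

/-- `Δ_{0,e} = det (M₀, M_e)`. -/
def Δ₀ (e : g.P) : g.AΓ := g.minor none (some e)

/-- For an ancestor `e'` of `e`, `Δ_{e',e}` is the exact quotient of `det (M_{e'}, M_e)` by the
nonzero polynomial `R_{e''}`, where `e''` is the child of `e'` lying below `e`. -/
def Δ {e' e : g.P} (hlt : e'.1 < e.1) : g.AΓ := (g.R_dvd_minor hlt).choose

theorem Δ_spec {e' e : g.P} (hlt : e'.1 < e.1) :
    g.minor (some e') (some e) = g.R (childToward hlt) * g.Δ hlt :=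
  (g.R_dvd_minor hlt).choose_spec

/-- The root polynomials are nonzero, so that the quotients `Δ_{e',e}` are uniquely determined. -/
theorem R_ne_zero (e : g.Node) : g.R e ≠ 0 := by
  classical
  induction e using WellFoundedLT.induction with
  | ind e ih =>
    by_cases he : e = g.root
    · rw [he, R_root]; exact one_ne_zero
    · rw [g.R_of_ne_root he]
      refine mul_ne_zero (Finset.prod_ne_zero_iff.2 fun f _ => ?_) (ih _ (par_lt e he))
      intro h0
      have hX : ∃ i, g.XPar (par e he) = MvPolynomial.X i := by
        unfold XPar; split_ifs
        · exact ⟨_, rfl⟩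
        · exact ⟨_, rfl⟩
      obtain ⟨i, hi⟩ := hX
      rw [hi] at h0
      have h1 := congrArg (MvPolynomial.eval
        (fun _ => Polynomial.C (g.lb ⟨f.1, ne_root_of_mem_Child f.2⟩) + 1)) h0
      simp [label] at h1

/-- The ideal `I_g` of `A[Γ]`. -/
def I : Ideal g.AΓ :=
  Ideal.span ({p | ∃ e : g.P, p = g.Δ₀ e} ∪
    {p | ∃ (e' e : g.P) (hlt : e'.1 ∈ g.Anc e.1), p = g.Δ hlt})

/-- The `A`-algebra `B_g = A[Γ] / I_g`. -/
abbrev B : Type := g.AΓ ⧸ g.I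

/-- The affine scheme `V_g = Spec B_g`. -/
def V : Scheme := Spec (CommRingCat.of g.B)

/-- The affine line `Z = Spec ℂ[h]`. -/
def _root_.Danielewski.Z : Scheme := Spec (CommRingCat.of A)

/-- The structure morphism `q_g : V_g ⟶ Z`, induced by `A → B_g`. -/
def q : g.V ⟶ Z := Spec.map (CommRingCat.ofHom (algebraMap A g.B))

end LabelledRootedTree

/-- A scheme is nonsingular (regular) if it is locally Noetherian and all of its local rings are
regular local rings. -/
def IsNonsingular (X : Scheme) : Prop :=
  IsLocallyNoetherian X ∧ ∀ x : X, IsRegularLocalRing (X.presheaf.stalk x)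

/-- A scheme is a surface if it is integral and of dimension two. -/
def IsSurface (X : Scheme) : Prop :=
  IsIntegral X ∧ topologicalKrullDim X = 2

end Danielewski

end

/-! For each leaf `l`, the open set of `V_g` where `R_l` is invertible is a principal open subset of
the plane Spec `ℂ[h][u]`, defined by some `ρ` that is a nonzero constant modulo `h`
(`exists_localization_equiv`). These open sets cover `V_g` (`exists_isMax_R_notMem`), so smoothness,
regularity and dimension 2 can be read off locally.

The coordinate is built along the path from the root to `l` (`IsChart.exists_child`). For a child
`f` of `e` one has `Q_e = (X_{Par(e)} - lb(f)) R_f`. Hence where `R_f` is invertible, `h X_e = Q_e`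
says that `X_{Par(e)}` equals `lb(f)` plus `h` times `X_e / R_f`. Modulo `h`, `X_{Par(e)}` is affine
in the old coordinate with nonzero slope, so that coordinate has the form `a + h w`, and `w` is the
new one. Fineness keeps `R_f` a nonzero constant modulo `h`. A variable `X_e` off the path is
recovered from `Δ_{e₀,e}`, where `e₀` is the node at which `e` branches off: its coefficient there
is a factor of `R_l`.

Integrality is global: `h` is a nonzerodivisor on `B_g`, and once `h` is inverted every element is a
polynomial in `X₀`, so `B_g` embeds in the fraction field of `ℂ[h][u]` (`isDomain_B`). -/

open AlgebraicGeometry CategoryTheory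

noncomputable section

namespace Danielewski

namespace LabelledRootedTree

open FinRootedTree

variable (g : LabelledRootedTree)

/-! ### Variables and factors of `R_e`, `Q_e` and `Δ_{e',e}` -/

/-- The variables `X₀` and `X_f` with `f < e`. -/
def below (e : g.Node) : Set (Option g.P) := {i | ∀ f : g.P, i = some f → f.1 < e}

variable {g}

theorem none_mem_below (e : g.Node) : none ∈ g.below e := by simp [below]

theorem some_mem_below {e : g.Node} {f : g.P} : some f ∈ g.below e ↔ f.1 < e :=
  ⟨fun h => h f rfl, fun h f' hf' => by cases hf'; exact h⟩

theorem below_mono {e e' : g.Node} (h : e ≤ e') : g.below e ⊆ g.below e' :=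
  fun _ hi f hf => (hi f hf).trans_le h

theorem XPar_root : g.XPar g.root = g.X₀ := by simp [XPar]

theorem XPar_of_mem_Child {e f : g.Node} (hf : f ∈ g.Child e) (he : ¬ IsMax e) :
    g.XPar f = g.X ⟨e, he⟩ := by
  have := par_eq_of_mem_Child hf
  simp [XPar, ne_root_of_mem_Child hf, this]

theorem XPar_mem_supported (e : g.Node) : g.XPar e ∈ MvPolynomial.supported A (g.below e) := by
  unfold XPar
  split_ifs with he
  · exact MvPolynomial.X_mem_supported.2 (none_mem_below e)
  · exact MvPolynomial.X_mem_supported.2 (some_mem_below.2 (par_lt e he))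

theorem S_mem_supported (e : g.Node) (J : Finset g.Node) :
    g.S e J ∈ MvPolynomial.supported A (g.below e) :=
  Subalgebra.prod_mem _ fun _ _ => Subalgebra.sub_mem _ (XPar_mem_supported e)
    (Subalgebra.algebraMap_mem _ _)

theorem R_mem_supported (e : g.Node) : g.R e ∈ MvPolynomial.supported A (g.below e) := by
  induction e using WellFoundedLT.induction with
  | ind e ih =>
    by_cases he : e = g.root
    · subst he; rw [R_root]; exact Subalgebra.one_mem _
    · rw [g.R_of_ne_root he]
      have hle := (par_lt e he).le
      exact Subalgebra.mul_mem _
        (MvPolynomial.supported_mono (below_mono hle) (S_mem_supported _ _))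
        (MvPolynomial.supported_mono (below_mono hle) (ih _ (par_lt e he)))

theorem Q_mem_supported (e : g.Node) : g.Q e ∈ MvPolynomial.supported A (g.below e) :=
  Subalgebra.mul_mem _ (S_mem_supported _ _) (R_mem_supported _)

theorem R_eq_of_mem_Child {e f : g.Node} (hf : f ∈ g.Child e) : g.R f = g.S e {f} * g.R e := by
  rw [g.R_of_ne_root (ne_root_of_mem_Child hf), par_eq_of_mem_Child hf]

/-- Sharper than `R_mem_supported f`: the variable `X_e` itself does not occur, so `X_e` can be
defined in terms of `R_f`. -/
theorem R_mem_supported_of_mem_Child {e f : g.Node} (hf : f ∈ g.Child e) :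
    g.R f ∈ MvPolynomial.supported A (g.below e) := by
  rw [R_eq_of_mem_Child hf]
  exact Subalgebra.mul_mem _ (S_mem_supported _ _) (R_mem_supported _)

/-- The factor `X_{Par(e)} - lb(f)` attached to a child `f` of `e`. -/
def factor {e f : g.Node} (hf : f ∈ g.Child e) : g.AΓ :=
  g.XPar e - g.label f (ne_root_of_mem_Child hf)

theorem factor_mem_supported {e f : g.Node} (hf : f ∈ g.Child e) :
    factor hf ∈ MvPolynomial.supported A (g.below e) :=
  Subalgebra.sub_mem _ (XPar_mem_supported e) (Subalgebra.algebraMap_mem _ _)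

theorem Q_eq_of_mem_Child {e f : g.Node} (hf : f ∈ g.Child e) : g.Q e = factor hf * g.R f := by
  classical
  rw [R_eq_of_mem_Child hf, Q, ← mul_assoc]
  congr 1
  have h1 : (g.Child e).attach.filter (fun x => x.1 ∉ (∅ : Finset g.Node)) =
      insert ⟨f, hf⟩ ((g.Child e).attach.filter (fun x => x.1 ∉ ({f} : Finset g.Node))) := by
    ext x
    by_cases hx : x.1 = f <;> simp [Subtype.ext_iff, hx]
  unfold S
  rw [h1, Finset.prod_insert (by simp)]
  rfl

theorem factor_dvd_R {e f f' : g.Node} (hf : f ∈ g.Child e) (hf' : f' ∈ g.Child e)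
    (hne : f' ≠ f) : factor hf' ∣ g.R f := by
  classical
  rw [R_eq_of_mem_Child hf]
  refine Dvd.dvd.mul_right ?_ _
  exact Finset.dvd_prod_of_mem
    (fun f : {x // x ∈ g.Child e} => g.XPar e - g.label f.1 (ne_root_of_mem_Child f.2))
    (a := ⟨f', hf'⟩) (by simp [hne])

theorem Δ₀_eq (e : g.P) : g.Δ₀ e = g.h * g.X e - g.Q e.1 := by
  simp [Δ₀, minor, Matrix.det_fin_two, M]

theorem R_mul_Δ {e' e : g.P} (hlt : e'.1 < e.1) :
    g.R (childToward hlt) * g.Δ hlt = g.Q e'.1 * g.X e - g.Q e.1 * g.X e' := by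
  rw [← g.Δ_spec hlt]
  simp [minor, Matrix.det_fin_two, M]

theorem R_childToward_dvd_Q {e' e : g.Node} (hlt : e' < e) : g.R (childToward hlt) ∣ g.Q e :=
  (g.R_dvd_R (childToward_le hlt)).mul_left _

/-- Cancelling `R_{e''}` makes the exact division explicit. If `U` involves only variables below
`e`, the result is linear in `X_e`, with a single factor of `Q_{e'}` as coefficient. -/
theorem Δ_eq {e' e : g.P} (hlt : e'.1 < e.1) {U : g.AΓ}
    (hU : g.Q e.1 = g.R (childToward hlt) * U) :
    g.Δ hlt = factor (childToward_mem hlt) * g.X e - U * g.X e' := by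
  apply mul_left_cancel₀ (g.R_ne_zero (childToward hlt))
  rw [R_mul_Δ, Q_eq_of_mem_Child (childToward_mem hlt), hU]
  ring

/-! ### Solutions of `h X_e = Q_e` and homomorphisms out of `B_g` -/

section Solutions

variable {C : Type*} [CommRing C] [Algebra A C]

theorem aeval_congr_of_mem_supported {s : Set (Option g.P)} {p : g.AΓ}
    (hp : p ∈ MvPolynomial.supported A s) {x x' : Option g.P → C} (h : ∀ i ∈ s, x i = x' i) :
    MvPolynomial.aeval x p = MvPolynomial.aeval x' p := by
  have : s.EqOn x x' := h
  rw [MvPolynomial.supported_eq_adjoin_X] at hp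
  refine AlgHom.eqOn_adjoin_iff.2 ?_ hp
  rintro _ ⟨i, hi, rfl⟩
  simp [h i hi]

theorem aeval_mem_of_mem_supported {s : Set (Option g.P)} {p : g.AΓ}
    (hp : p ∈ MvPolynomial.supported A s) {x : Option g.P → C} {T : Subalgebra A C}
    (h : ∀ i ∈ s, x i ∈ T) : MvPolynomial.aeval x p ∈ T := by
  rw [MvPolynomial.supported_eq_adjoin_X] at hp
  have : Algebra.adjoin A (MvPolynomial.X '' s) ≤ T.comap (MvPolynomial.aeval x) := by
    refine Algebra.adjoin_le ?_
    rintro _ ⟨i, hi, rfl⟩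
    simpa using h i hi
  exact this hp

/-- The relations `h X_f = Q_f` hold at `x` for all `f < e`. -/
def IsSolBelow (e : g.Node) (x : Option g.P → C) : Prop :=
  ∀ f : g.P, f.1 < e → algebraMap A C Polynomial.X * x (some f) = MvPolynomial.aeval x (g.Q f.1)

/-- The relations `h X_f = Q_f` hold at `x` for all parents `f`. -/
def IsSol (x : Option g.P → C) : Prop :=
  ∀ f : g.P, algebraMap A C Polynomial.X * x (some f) = MvPolynomial.aeval x (g.Q f.1)

theorem IsSol.isSolBelow {x : Option g.P → C} (hx : IsSol x) (e : g.Node) : IsSolBelow e x :=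
  fun f _ => hx f

/-- The relations `Δ_{e',e}` follow from the `Δ_{0,e}` up to `h`-torsion: with `F` the factor of
`Q_{e'}` pointing towards `e` and `Q_e = R_{e''} U`, one has `h Δ_{e',e} = F (h X_e - Q_e) - U (h
X_{e'} - Q_{e'})`. -/
theorem aeval_I_eq_zero (hC : ∀ c : C, algebraMap A C Polynomial.X * c = 0 → c = 0)
    {x : Option g.P → C} (hx : IsSol x) {p : g.AΓ} (hp : p ∈ g.I) :
    MvPolynomial.aeval x p = 0 := by
  suffices g.I ≤ RingHom.ker (MvPolynomial.aeval (R := A) x) from this hp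
  refine Ideal.span_le.2 ?_
  have hX : ∀ f, MvPolynomial.aeval x (g.X f) = x (some f) := fun f => by simp [X]
  rintro _ (⟨e, rfl⟩ | ⟨e', e, hlt, rfl⟩)
  · have : MvPolynomial.aeval x g.h = algebraMap A C Polynomial.X := by
      simp [h]
    simp [Δ₀_eq, RingHom.mem_ker, hX, this, hx e]
  · obtain ⟨U, hU⟩ := R_childToward_dvd_Q hlt
    refine hC _ ?_
    have h1 := hx e
    have h2 := hx e'
    rw [hU] at h1
    rw [Q_eq_of_mem_Child (childToward_mem hlt)] at h2
    rw [map_mul] at h1 h2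
    change algebraMap A C Polynomial.X * MvPolynomial.aeval x (g.Δ hlt) = 0
    rw [Δ_eq hlt hU]
    simp only [map_sub, map_mul, hX]
    linear_combination MvPolynomial.aeval x (factor (childToward_mem hlt)) * h1 -
      MvPolynomial.aeval x U * h2

/-- A solution of the relations in a ring where `h` is a nonzerodivisor defines a homomorphism
out of `B_g`. -/
def lift (hC : ∀ c : C, algebraMap A C Polynomial.X * c = 0 → c = 0)
    {x : Option g.P → C} (hx : IsSol x) : g.B →ₐ[A] C :=
  Ideal.Quotient.liftₐ g.I (MvPolynomial.aeval x) fun _ => aeval_I_eq_zero hC hx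

variable (g) in
/-- The class in `B_g` of a variable of `A[Γ]`. -/
def gen (i : Option g.P) : g.B := Ideal.Quotient.mk g.I (MvPolynomial.X i)

theorem lift_gen (hC : ∀ c : C, algebraMap A C Polynomial.X * c = 0 → c = 0)
    {x : Option g.P → C} (hx : IsSol x) (i : Option g.P) : lift hC hx (g.gen i) = x i := by
  change MvPolynomial.aeval x (MvPolynomial.X i) = x i
  simp

theorem map_mk (χ : g.B →ₐ[A] C) (p : g.AΓ) :
    χ (Ideal.Quotient.mk g.I p) = MvPolynomial.aeval (fun i => χ (g.gen i)) p := by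
  have : χ.comp (Ideal.Quotient.mkₐ A g.I) = MvPolynomial.aeval (fun i => χ (g.gen i)) := by
    ext i
    simp [gen]
  exact DFunLike.congr_fun this p

theorem algHom_ext_gen {χ χ' : g.B →ₐ[A] C} (h : ∀ i, χ (g.gen i) = χ' (g.gen i)) : χ = χ' := by
  ext b
  obtain ⟨p, rfl⟩ := Ideal.Quotient.mk_surjective b
  rw [map_mk, map_mk, funext h]

theorem aeval_gen_eq_zero (χ : g.B →ₐ[A] C) {p : g.AΓ} (hp : p ∈ g.I) :
    MvPolynomial.aeval (fun i => χ (g.gen i)) p = 0 := by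
  rw [← map_mk, Ideal.Quotient.eq_zero_iff_mem.2 hp, map_zero]

theorem isSol_gen (χ : g.B →ₐ[A] C) : IsSol (fun i => χ (g.gen i)) := by
  intro f
  have := aeval_gen_eq_zero χ (Ideal.subset_span (Or.inl ⟨f, rfl⟩) : g.Δ₀ f ∈ g.I)
  rw [Δ₀_eq] at this
  simpa [h, X, sub_eq_zero] using this

theorem Δ_gen (χ : g.B →ₐ[A] C) {e' e : g.P} (hlt : e'.1 < e.1) :
    MvPolynomial.aeval (fun i => χ (g.gen i)) (g.Δ hlt) = 0 :=
  aeval_gen_eq_zero χ (Ideal.subset_span (Or.inr ⟨e', e, hlt, rfl⟩))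

end Solutions

/-! ### Reduction modulo `h` and the substitution `u ↦ a + h u` -/

/-- Reduction modulo `h` on `ℂ[h][u]`. -/
def modH : Polynomial A →+* Polynomial ℂ := Polynomial.mapRingHom (Polynomial.evalRingHom 0)

@[simp] theorem modH_X : modH Polynomial.X = Polynomial.X := by simp [modH]

@[simp] theorem modH_C (a : A) : modH (Polynomial.C a) = Polynomial.C (a.eval 0) := by simp [modH]

theorem exists_eq_add_of_modH_eq {p q : Polynomial A} (hpq : modH p = modH q) :
    ∃ G, p = q + Polynomial.C Polynomial.X * G := by
  have hdvd : Polynomial.C (Polynomial.X : A) ∣ p - q := by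
    rw [Polynomial.C_dvd_iff_dvd_coeff]
    intro i
    have := congrArg (fun r => Polynomial.coeff r i) hpq
    simp only [modH, Polynomial.coe_mapRingHom, Polynomial.coeff_map,
      Polynomial.coe_evalRingHom, ← Polynomial.coeff_zero_eq_eval_zero] at this
    rw [Polynomial.X_dvd_iff, Polynomial.coeff_sub, Polynomial.coeff_sub, this, sub_self]
  obtain ⟨G, hG⟩ := hdvd
  exact ⟨G, by rw [← hG]; ring⟩

/-- The substitution `u ↦ a + h u` on `ℂ[h][u]`. -/
def shift (a : ℂ) : Polynomial A →ₐ[A] Polynomial A :=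
  Polynomial.aeval (Polynomial.C (Polynomial.C a) + Polynomial.C Polynomial.X * Polynomial.X)

theorem shift_X (a : ℂ) : shift a Polynomial.X =
    Polynomial.C (Polynomial.C a) + Polynomial.C Polynomial.X * Polynomial.X := by
  simp [shift]

theorem shift_C (a : ℂ) (b : A) : shift a (Polynomial.C b) = Polynomial.C b := by
  simp [shift]

theorem modH_shift (a : ℂ) (p : Polynomial A) :
    modH (shift a p) = Polynomial.C ((modH p).eval a) := by
  have : modH.comp (shift a).toRingHom =
      (Polynomial.C.comp (Polynomial.evalRingHom a)).comp modH := by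
    refine Polynomial.ringHom_ext (fun b => ?_) ?_
    · simp [shift_C]
    · simp [shift_X]
  exact DFunLike.congr_fun this p

theorem aeval_shift {C : Type*} [CommRing C] [Algebra A C] (a : ℂ) (w : C) (p : Polynomial A) :
    Polynomial.aeval w (shift a p) =
      Polynomial.aeval (algebraMap A C (Polynomial.C a) + algebraMap A C Polynomial.X * w) p := by
  have : (Polynomial.aeval w).comp (shift a) = Polynomial.aeval
      (algebraMap A C (Polynomial.C a) + algebraMap A C Polynomial.X * w) := by
    ext
    simp [shift_X]
  exact DFunLike.congr_fun this p

theorem aeval_algHom {C D : Type*} [CommRing C] [Algebra A C] [CommRing D] [Algebra A D]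
    (θ : C →ₐ[A] D) (x : Option g.P → C) (p : g.AΓ) :
    MvPolynomial.aeval (fun i => θ (x i)) p = θ (MvPolynomial.aeval x p) := by
  have : MvPolynomial.aeval (fun i => θ (x i)) = θ.comp (MvPolynomial.aeval (R := A) x) := by
    ext; simp
  exact DFunLike.congr_fun this p

/-! ### Charts along a path from the root -/

/-- A chart along the path from the root to `e`: values `y` in `ℂ[h][u]` of the variables below
`e`, through which every solution with `R_e` invertible factors. -/
structure IsChart (e : g.Node) (y : Option g.P → Polynomial A) : Prop where
  sol : IsSolBelow e y
  modH_XPar : ∃ α β : ℂ, α ≠ 0 ∧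
    modH (MvPolynomial.aeval y (g.XPar e)) = Polynomial.C α * Polynomial.X + Polynomial.C β
  modH_R : ∃ ρ : ℂ, ρ ≠ 0 ∧ modH (MvPolynomial.aeval y (g.R e)) = Polynomial.C ρ
  none : ∃ (k : ℕ) (s : A),
    y none = Polynomial.C s + Polynomial.C (Polynomial.X ^ k) * Polynomial.X
  -- No condition on `h` is imposed on `C`: this is applied to a localization of `B_g`, where `h` is
  -- not yet known to be a nonzerodivisor.
  exists_coord : ∀ (C : Type) [CommRing C] [Algebra A C] (x : Option g.P → C), IsSolBelow e x →
    IsUnit (MvPolynomial.aeval x (g.R e)) →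
      ∃ v : C, ∀ i ∈ g.below e, x i = Polynomial.aeval v (y i)

theorem isChart_root : IsChart g.root (fun _ : Option g.P => Polynomial.X) where
  sol f hf := absurd hf (((g.isMin_iff g.root).2 rfl).not_lt)
  modH_XPar := ⟨1, 0, one_ne_zero, by simp [XPar_root, X₀]⟩
  modH_R := ⟨1, one_ne_zero, by simp [R_root]⟩
  none := ⟨0, 0, by simp⟩
  exists_coord C _ _ x _ _ := ⟨x none, fun i hi => by
    rcases i with _ | f
    · simp
    · exact absurd (some_mem_below.1 hi) (((g.isMin_iff g.root).2 rfl).not_lt)⟩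

theorem isMax_of_lt {e f : g.Node} (h : e < f) : ¬ IsMax e := fun h' => h'.not_lt h

theorem lt_child_iff {e f : g.Node} (hf : f ∈ g.Child e) (f' : g.Node) : f' < f ↔ f' ≤ e := by
  refine ⟨fun h => ?_, fun h => h.trans_lt (lt_of_mem_Child hf)⟩
  have := (par_spec f (ne_root_of_mem_Child hf)).2 h
  rwa [par_eq_of_mem_Child hf] at this

theorem aeval_label {C : Type*} [CommRing C] [Algebra A C] (x : Option g.P → C) (e : g.Node)
    (he : e ≠ g.root) :
    MvPolynomial.aeval x (g.label e he) = algebraMap A C (Polynomial.C (g.lb ⟨e, he⟩)) := by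
  simp [label]

theorem aeval_factor {C : Type*} [CommRing C] [Algebra A C] (x : Option g.P → C) {e f : g.Node}
    (hf : f ∈ g.Child e) : MvPolynomial.aeval x (factor hf) = MvPolynomial.aeval x (g.XPar e) -
      algebraMap A C (Polynomial.C (g.lb ⟨f, ne_root_of_mem_Child hf⟩)) := by
  rw [factor, map_sub, aeval_label]

/-- If `X_{Par(e)}` reduces modulo `h` to the label of the child `f`, then `S_e^{f}` reduces to a
nonzero constant. -/
theorem modH_S (hg : g.IsFine) {e f : g.Node} (hf : f ∈ g.Child e)
    {y : Option g.P → Polynomial A} (hy : modH (MvPolynomial.aeval y (g.XPar e)) =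
      Polynomial.C (g.lb ⟨f, ne_root_of_mem_Child hf⟩)) :
    ∃ ρ : ℂ, ρ ≠ 0 ∧ modH (MvPolynomial.aeval y (g.S e {f})) = Polynomial.C ρ := by
  classical
  refine ⟨∏ x ∈ (g.Child e).attach.filter (fun x => x.1 ∉ ({f} : Finset g.Node)),
    (g.lb ⟨f, ne_root_of_mem_Child hf⟩ - g.lb ⟨x.1, ne_root_of_mem_Child x.2⟩), ?_, ?_⟩
  · refine Finset.prod_ne_zero_iff.2 fun x hx => sub_ne_zero.2 (hg _ _ ?_ ?_)
    · intro h
      simp only [Finset.mem_filter, Finset.mem_singleton] at hx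
      exact hx.2 (Subtype.ext_iff.1 h).symm
    · rw [par_eq_of_mem_Child hf, par_eq_of_mem_Child x.2]
  · simp only [S, map_prod, map_sub, hy, aeval_label]
    refine Finset.prod_congr rfl fun x _ => ?_
    simp

/-- Substituting `u ↦ a + h u` makes `X_{Par(e)} - lb(f)` divisible by `h`; then `X_e` is forced to
be `R_f` times the quotient, and modulo `h` it is again affine in `u` with nonzero slope. -/
theorem IsChart.exists_child (hg : g.IsFine) {e f : g.Node} (hf : f ∈ g.Child e)
    {y : Option g.P → Polynomial A} (hy : IsChart e y) : ∃ y', IsChart f y' := by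
  classical
  have he : ¬ IsMax e := isMax_of_lt (lt_of_mem_Child hf)
  obtain ⟨α, β, hα, hXP⟩ := hy.modH_XPar
  obtain ⟨ρ, hρ, hR⟩ := hy.modH_R
  set c := g.lb ⟨f, ne_root_of_mem_Child hf⟩ with hc
  -- The value of `u` at which the reduction `α u + β` of `X_{Par(e)}` equals the label of `f`.
  set a : ℂ := (c - β) / α with ha
  obtain ⟨G, hG⟩ : ∃ G, MvPolynomial.aeval y (g.XPar e) = (Polynomial.C (Polynomial.C α) *
      Polynomial.X + Polynomial.C (Polynomial.C β)) + Polynomial.C Polynomial.X * G :=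
    exists_eq_add_of_modH_eq (by rw [hXP]; simp)
  have haβ : α * a + β = c := by rw [ha]; field_simp; ring
  set z : Option g.P → Polynomial A := fun i => shift a (y i) with hz
  -- `K` is `(X_{Par(e)} - c) / h` after the substitution.
  set K : Polynomial A := Polynomial.C (Polynomial.C α) * Polynomial.X + shift a G with hK
  set y' : Option g.P → Polynomial A :=
    Function.update z (some ⟨e, he⟩) (MvPolynomial.aeval z (g.R f) * K) with hy'
  have hyz : ∀ i ∈ g.below e, y' i = z i := fun i hi =>
    Function.update_of_ne (by rintro rfl; exact lt_irrefl _ (some_mem_below.1 hi)) _ _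
  have hyz' : ∀ {p : g.AΓ}, p ∈ MvPolynomial.supported A (g.below e) →
      MvPolynomial.aeval y' p = MvPolynomial.aeval z p := fun hp =>
    aeval_congr_of_mem_supported hp hyz
  have hye : y' (some ⟨e, he⟩) = MvPolynomial.aeval z (g.R f) * K := Function.update_self _ _ _
  have hzXP : MvPolynomial.aeval z (g.XPar e) =
      Polynomial.C (Polynomial.C c) + Polynomial.C Polynomial.X * K := by
    rw [hz, aeval_algHom, hG, map_add, map_add, map_mul, map_mul, shift_X, shift_C, shift_C,
      shift_C, hK, ← haβ]
    simp only [map_add, map_mul]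
    ring
  have hmodXP : modH (MvPolynomial.aeval z (g.XPar e)) = Polynomial.C c := by
    rw [hzXP]; simp
  have hmodR : ∃ σ : ℂ, σ ≠ 0 ∧ modH (MvPolynomial.aeval z (g.R f)) = Polynomial.C σ := by
    obtain ⟨τ, hτ, hS⟩ := modH_S hg hf hmodXP
    refine ⟨τ * ρ, mul_ne_zero hτ hρ, ?_⟩
    rw [R_eq_of_mem_Child hf, map_mul, map_mul, hS]
    rw [hz, aeval_algHom, modH_shift, hR]
    simp
  obtain ⟨σ, hσ, hσR⟩ := hmodR
  have hRf := R_mem_supported_of_mem_Child hf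
  have hfac : MvPolynomial.aeval z (factor hf) = Polynomial.C Polynomial.X * K := by
    rw [aeval_factor, hzXP]
    simp [hc]
  refine ⟨y', ⟨?_, ⟨σ * α, σ * (modH G).eval a, mul_ne_zero hσ hα, ?_⟩, ⟨σ, hσ, ?_⟩, ?_, ?_⟩⟩
  · intro f' hf'
    rcases ((lt_child_iff hf _).1 hf').eq_or_lt with h | h
    · obtain rfl : f' = ⟨e, he⟩ := Subtype.ext h
      rw [hye, hyz' (Q_mem_supported e), Q_eq_of_mem_Child hf, map_mul, hfac]
      simp only [Polynomial.algebraMap_eq]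
      ring
    · have h1 := congrArg (shift a) (hy.sol f' h)
      rw [hyz' (MvPolynomial.supported_mono (below_mono h.le) (Q_mem_supported f'.1)),
        hyz _ (some_mem_below.2 h), hz, aeval_algHom, ← h1, map_mul, AlgHom.commutes]
  · rw [XPar_of_mem_Child hf he, X, MvPolynomial.aeval_X, hye, map_mul, hσR, hK, map_add,
      modH_shift]
    simp
    ring
  · rw [hyz' hRf, hσR]
  · obtain ⟨k, s, hs⟩ := hy.none
    refine ⟨k + 1, s + Polynomial.X ^ k * Polynomial.C a, ?_⟩
    rw [hyz _ (none_mem_below e)]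
    simp only [hz]
    rw [hs, map_add, map_mul, shift_C, shift_C, shift_X]
    simp only [map_add, map_mul, map_pow]
    ring
  · intro C _ _ x hx hu
    have hxe : IsSolBelow e x := fun f' hf' => hx f' (hf'.trans (lt_of_mem_Child hf))
    have hue : IsUnit (MvPolynomial.aeval x (g.R e)) :=
      isUnit_of_dvd_unit (map_dvd _ ((R_eq_of_mem_Child hf) ▸ dvd_mul_left _ _)) hu
    obtain ⟨v, hv⟩ := hy.exists_coord C x hxe hue
    obtain ⟨r, hr⟩ := hu.exists_right_inv
    have hA : algebraMap A C (Polynomial.C α⁻¹) * algebraMap A C (Polynomial.C α) = 1 := by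
      rw [← map_mul, ← Polynomial.C_mul, inv_mul_cancel₀ hα]; simp
    have hxv : ∀ {p : g.AΓ}, p ∈ MvPolynomial.supported A (g.below e) →
        MvPolynomial.aeval x p = Polynomial.aeval v (MvPolynomial.aeval y p) := fun hp => by
      rw [aeval_congr_of_mem_supported hp hv, aeval_algHom]
    have hxP : MvPolynomial.aeval x (g.XPar e) =
        algebraMap A C (Polynomial.C α) * v + algebraMap A C (Polynomial.C β) +
          algebraMap A C Polynomial.X * Polynomial.aeval v G := by
      rw [hxv (XPar_mem_supported e), hG]
      simp
    have hxQ : algebraMap A C Polynomial.X * x (some ⟨e, he⟩) =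
        (MvPolynomial.aeval x (g.XPar e) - algebraMap A C (Polynomial.C c)) *
          MvPolynomial.aeval x (g.R f) := by
      rw [hx ⟨e, he⟩ (lt_of_mem_Child hf), Q_eq_of_mem_Child hf, map_mul, aeval_factor]
    -- Since `r` inverts `R_f`, the relation gives `α v + β + h G(v) = c + h x_e r`. Solving for the
    -- linear term yields `v = a + h w` without dividing by `h`.
    set w : C := algebraMap A C (Polynomial.C α⁻¹) *
      (x (some ⟨e, he⟩) * r - Polynomial.aeval v G) with hw
    have hcA : algebraMap A C (Polynomial.C c) = algebraMap A C (Polynomial.C α) *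
        algebraMap A C (Polynomial.C a) + algebraMap A C (Polynomial.C β) := by
      rw [← haβ]; simp
    have hvw : v = algebraMap A C (Polynomial.C a) + algebraMap A C Polynomial.X * w := by
      rw [hxP, hcA] at hxQ
      rw [hw]
      linear_combination (algebraMap A C (Polynomial.C a) - v) * hA
        - algebraMap A C (Polynomial.C α⁻¹) * r * hxQ
        + (v * algebraMap A C (Polynomial.C α) -
          algebraMap A C (Polynomial.C α) * algebraMap A C (Polynomial.C a)
          + algebraMap A C Polynomial.X * Polynomial.aeval v G) *
          algebraMap A C (Polynomial.C α⁻¹) * (- hr)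
    have hxz : ∀ i ∈ g.below e, x i = Polynomial.aeval w (z i) := fun i hi => by
      rw [hv i hi, hz, aeval_shift, ← hvw]
    refine ⟨w, fun i hi => ?_⟩
    by_cases hie : i = some ⟨e, he⟩
    · have hKw : Polynomial.aeval w K = x (some ⟨e, he⟩) * r := by
        rw [hK, map_add, aeval_shift, ← hvw, hw]
        simp only [map_mul, Polynomial.aeval_C, Polynomial.aeval_X]
        linear_combination (x (some ⟨e, he⟩) * r - Polynomial.aeval v G) * hA
      rw [hie, hye, map_mul, hKw, ← aeval_algHom, ← aeval_congr_of_mem_supported hRf hxz]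
      linear_combination -x (some ⟨e, he⟩) * hr
    · have : i ∈ g.below e := fun f' hf' => by
        refine ((lt_child_iff hf _).1 (hi f' hf')).lt_of_ne fun h => hie ?_
        rw [hf']
        exact congrArg some (Subtype.ext h)
      rw [hyz i this]
      exact hxz i this

theorem exists_isChart (hg : g.IsFine) (e : g.Node) : ∃ y : Option g.P → Polynomial A,
    IsChart e y := by
  induction e using WellFoundedLT.induction with
  | ind e ih =>
    by_cases he : e = g.root
    · exact ⟨_, he ▸ isChart_root⟩
    · obtain ⟨y, hy⟩ := ih _ (par_lt e he)
      exact hy.exists_child hg (mem_Child_par e he)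

/-! ### Nodes off the path to a leaf -/

theorem root_le (e : g.Node) : g.root ≤ e := by
  induction e using WellFoundedLT.induction with
  | ind e ih =>
    by_cases he : e = g.root
    · exact he.ge
    · exact (ih _ (par_lt e he)).trans (par_lt e he).le

/-- A parent `e` that is not an ancestor of the leaf `l` branches off from the path to `l`. -/
theorem exists_fork {e l : g.Node} (hl : IsMax l) (he : ¬ IsMax e) (hel : ¬ e < l) :
    ∃ (e₀ : g.Node) (h₁ : e₀ < e) (h₂ : e₀ < l), childToward h₁ ≠ childToward h₂ := by
  have hle : ¬ l ≤ e := fun h => he (le_antisymm (hl h) h ▸ hl)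
  have hroot : g.root < l := (root_le l).lt_of_ne fun h => hle (h ▸ root_le e)
  -- The last common node of the two paths: a common child towards `e` and `l` would be a larger
  -- element of this set.
  obtain ⟨e₀, h₀⟩ :=
    (Set.toFinite {f | f ≤ e ∧ f < l}).exists_maximal ⟨g.root, root_le e, hroot⟩
  have h₁ : e₀ < e := h₀.prop.1.lt_of_ne fun h => hel (h ▸ h₀.prop.2)
  refine ⟨e₀, h₁, h₀.prop.2, fun h => ?_⟩
  have h3 := childToward_le h₁
  have h4 : childToward h₁ ≤ l := h ▸ childToward_le h₀.prop.2
  have h5 : childToward h₁ < l := h4.lt_of_ne fun h => hle (h ▸ h3)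
  exact (lt_of_mem_Child (childToward_mem h₁)).not_ge
    (h₀.le_of_ge ⟨h3, h5⟩ (lt_of_mem_Child (childToward_mem h₁)).le)

/-- Refines `R_dvd_R` by controlling the variables of the cofactor, as recursion on the tree
requires. -/
theorem exists_R_eq_R_mul {f e : g.Node} (hfe : f ≤ e) :
    ∃ U ∈ MvPolynomial.supported A (g.below e), g.R e = g.R f * U := by
  induction e using WellFoundedLT.induction with
  | ind e ih =>
    rcases hfe.eq_or_lt with rfl | hlt
    · exact ⟨1, Subalgebra.one_mem _, (mul_one _).symm⟩
    · have he : e ≠ g.root := fun h => ((g.isMin_iff e).2 h).not_lt hlt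
      obtain ⟨U, hU, hR⟩ := ih _ (par_lt e he) ((par_spec e he).2 hlt)
      have hmono := MvPolynomial.supported_mono (R := A) (below_mono (par_lt e he).le)
      refine ⟨U * g.S (par e he) {e}, Subalgebra.mul_mem _ (hmono hU)
        (hmono (S_mem_supported _ _)), ?_⟩
      rw [g.R_of_ne_root he, hR]
      ring

theorem exists_Q_eq_R_mul {f e : g.Node} (hfe : f ≤ e) :
    ∃ U ∈ MvPolynomial.supported A (g.below e), g.Q e = g.R f * U := by
  obtain ⟨U, hU, hR⟩ := exists_R_eq_R_mul hfe
  refine ⟨U * g.S e ∅, Subalgebra.mul_mem _ hU (S_mem_supported _ _), ?_⟩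
  rw [Q, hR]
  ring

theorem factor_dvd_R_of_fork {e₀ e l : g.Node} (h₁ : e₀ < e) (h₂ : e₀ < l)
    (hne : childToward h₁ ≠ childToward h₂) : factor (childToward_mem h₁) ∣ g.R l :=
  (factor_dvd_R (childToward_mem h₂) (childToward_mem h₁) hne).trans
    (g.R_dvd_R (childToward_le h₂))

/-! ### Uniqueness and extension of solutions over the whole tree -/

section Solutions

variable {C : Type*} [CommRing C] [Algebra A C]

/-- Where the root polynomial of a leaf `l` is invertible, a homomorphism out of `B_g` is
determined by the values of the variables below `l`. -/
theorem algHom_ext_of_isUnit {l : g.Node} (hl : IsMax l) {χ χ' : g.B →ₐ[A] C}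
    (hu : IsUnit (χ (Ideal.Quotient.mk g.I (g.R l))))
    (h : ∀ i ∈ g.below l, χ (g.gen i) = χ' (g.gen i)) : χ = χ' := by
  refine algHom_ext_gen fun i => ?_
  rcases i with _ | e
  · exact h _ (none_mem_below l)
  induction e using WellFoundedLT.induction with
  | ind e ih =>
    by_cases hel : e.1 < l
    · exact h _ (some_mem_below.2 hel)
    -- The relation `Δ_{e₀,e}` expresses `X_e` through variables below `e`, because its coefficient
    -- divides `R_l` and is therefore a unit.
    · obtain ⟨e₀, h₁, h₂, hne⟩ := exists_fork hl e.2 hel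
      obtain ⟨U, hU, hQ⟩ := exists_Q_eq_R_mul (childToward_le h₁)
      let e' : g.P := ⟨e₀, isMax_of_lt h₁⟩
      have h₁' : e'.1 < e.1 := h₁
      have hbelow : ∀ i ∈ g.below e.1, χ (g.gen i) = χ' (g.gen i) := fun i hi => by
        rcases i with _ | f
        · exact h _ (none_mem_below l)
        · exact ih f (some_mem_below.1 hi)
      have hfac : IsUnit (MvPolynomial.aeval (fun i => χ (g.gen i))
          (factor (childToward_mem h₁))) := by
        rw [map_mk] at hu
        exact isUnit_of_dvd_unit (map_dvd _ (factor_dvd_R_of_fork h₁ h₂ hne)) hu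
      have hs := MvPolynomial.supported_mono (R := A) (below_mono h₁.le)
        (factor_mem_supported (childToward_mem h₁))
      have e1 := Δ_gen χ h₁'
      have e2 := Δ_gen χ' h₁'
      rw [Δ_eq h₁' hQ] at e1 e2
      simp only [map_sub, map_mul, X, MvPolynomial.aeval_X] at e1 e2
      rw [← aeval_congr_of_mem_supported hU hbelow, ← aeval_congr_of_mem_supported hs hbelow,
        ← ih e' h₁'] at e2
      refine hfac.mul_left_cancel ?_
      linear_combination e1 - e2

/-- If each equation `h z = Q_e` can be solved on top of any solution below `e`, then there is a
solution for the whole tree. -/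
theorem exists_isSol (t : C) (H : ∀ (e : g.P) (x : Option g.P → C), x none = t →
    IsSolBelow e.1 x → ∃ z, algebraMap A C Polynomial.X * z = MvPolynomial.aeval x (g.Q e.1)) :
    ∃ x : Option g.P → C, IsSol x ∧ x none = t := by
  classical
  -- The default value 0 is harmless, since `Q_e` involves only variables below `e`. Solvability
  -- depends on the earlier values being solutions, so `Classical.epsilon` chooses first and the
  -- induction below justifies the choice.
  let ext (e : g.P) (ih : ∀ f : g.P, f < e → C) : Option g.P → C :=
    fun i => i.elim t fun f => if hf : f < e then ih f hf else 0
  let step (e : g.P) (ih : ∀ f : g.P, f < e → C) : C :=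
    Classical.epsilon fun z =>
      algebraMap A C Polynomial.X * z = MvPolynomial.aeval (ext e ih) (g.Q e.1)
  let F : g.P → C := wellFounded_lt.fix step
  let x : Option g.P → C := fun i => i.elim t F
  have hF : ∀ e, F e = step e fun f _ => F f := fun e => WellFounded.fix_eq _ _ _
  have hext : ∀ e, ∀ i ∈ g.below e.1, ext e (fun f _ => F f) i = x i := by
    intro e i hi
    rcases i with _ | f
    · rfl
    · have : f < e := some_mem_below.1 hi
      simp [ext, x, this]
  refine ⟨x, fun e => ?_, rfl⟩
  induction e using WellFoundedLT.induction with
  | ind e ih =>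
    have h1 := Classical.epsilon_spec (H e x rfl fun f hf => ih f hf)
    have h2 : x (some e) = step e fun f _ => F f := hF e
    rw [h2]
    simp only [step, aeval_congr_of_mem_supported (Q_mem_supported e.1) (hext e)]
    exact h1

/-- Each `h X_f = Q_f` determines `X_f` from earlier variables once `h` can be cancelled, so
everything is determined by `X₀`. -/
theorem eq_of_isSolBelow (hC : ∀ c : C, algebraMap A C Polynomial.X * c = 0 → c = 0)
    {e : g.Node} {x x' : Option g.P → C} (hx : IsSolBelow e x) (hx' : IsSolBelow e x')
    (h : x none = x' none) : ∀ i ∈ g.below e, x i = x' i := by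
  intro i hi
  rcases i with _ | f
  · exact h
  have hf := some_mem_below.1 hi
  clear hi
  induction f using WellFoundedLT.induction with
  | ind f ih =>
    have := aeval_congr_of_mem_supported (Q_mem_supported f.1) (x := x) (x' := x') (fun i hi => by
      rcases i with _ | f'
      · exact h
      · exact ih f' (some_mem_below.1 hi) ((some_mem_below.1 hi).trans hf))
    rw [← hx f hf, ← hx' f hf] at this
    exact sub_eq_zero.1 (hC _ (by rw [mul_sub, this, sub_self]))

/-- A solution below a leaf at which the root polynomial of the leaf is invertible extends to the
whole tree. -/
theorem IsSolBelow.exists_isSol (hC : ∀ c : C, algebraMap A C Polynomial.X * c = 0 → c = 0)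
    {l : g.Node} (hl : IsMax l) {y : Option g.P → C} (hy : IsSolBelow l y)
    (hu : IsUnit (MvPolynomial.aeval y (g.R l))) :
    ∃ x : Option g.P → C, IsSol x ∧ ∀ i ∈ g.below l, x i = y i := by
  obtain ⟨x, hx, hx0⟩ := LabelledRootedTree.exists_isSol (g := g) (y none) fun e x hx0 hx => by
    have hxy : ∀ e' ≤ e.1, e' ≤ l → ∀ i ∈ g.below e', x i = y i := fun e' he hl =>
      eq_of_isSolBelow hC (fun f hf => hx f (hf.trans_le he)) (fun f hf => hy f (hf.trans_le hl))
        hx0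
    by_cases hel : e.1 < l
    · refine ⟨y (some e), ?_⟩
      rw [hy e hel, aeval_congr_of_mem_supported (Q_mem_supported e.1) (hxy _ le_rfl hel.le)]
    · obtain ⟨e₀, h₁, h₂, hne⟩ := exists_fork hl e.2 hel
      obtain ⟨U, hU, hQ⟩ := exists_Q_eq_R_mul (childToward_le h₁)
      have hfac := isUnit_of_dvd_unit (map_dvd _ (factor_dvd_R_of_fork h₁ h₂ hne)) hu
      rw [← aeval_congr_of_mem_supported (factor_mem_supported (childToward_mem h₁))
        (hxy _ h₁.le h₂.le)] at hfac
      obtain ⟨r, hr⟩ := hfac.exists_right_inv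
      have h3 := hx ⟨e₀, isMax_of_lt h₁⟩ h₁
      rw [Q_eq_of_mem_Child (childToward_mem h₁), map_mul] at h3
      -- This is the value of `X_e` dictated by `Δ_{e₀,e} = 0`, with `r` the inverse of its
      -- coefficient.
      refine ⟨x (some ⟨e₀, isMax_of_lt h₁⟩) * r * MvPolynomial.aeval x U, ?_⟩
      rw [hQ, map_mul]
      linear_combination r * MvPolynomial.aeval x U * h3 +
        MvPolynomial.aeval x (g.R (childToward h₁)) * MvPolynomial.aeval x U * hr
  exact ⟨x, hx, eq_of_isSolBelow hC (hx.isSolBelow l) hy hx0⟩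

end Solutions

/-! ### The open sets attached to the leaves and their covering property -/

theorem X_mul_eq_zero_of_isDomain {D : Type*} [CommRing D] [IsDomain D] [Algebra A D]
    (hD : algebraMap A D Polynomial.X ≠ 0) (d : D) (hd : algebraMap A D Polynomial.X * d = 0) :
    d = 0 :=
  (mul_eq_zero.1 hd).resolve_left hD

/-- The open subset of `V_g` where the root polynomial of a leaf is invertible is isomorphic to a
principal open subset of the affine plane over `ℂ`. -/
theorem exists_localization_equiv (hg : g.IsFine) {l : g.Node} (hl : IsMax l) :
    ∃ (ρ : Polynomial A) (c : ℂ), c ≠ 0 ∧ modH ρ = Polynomial.C c ∧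
      Nonempty (Localization.Away (Ideal.Quotient.mk g.I (g.R l)) ≃ₐ[A] Localization.Away ρ) := by
  obtain ⟨y, hy⟩ := exists_isChart hg l
  obtain ⟨c, hc, hρ⟩ := hy.modH_R
  refine ⟨_, c, hc, hρ, ?_⟩
  set ρ : Polynomial A := MvPolynomial.aeval y (g.R l) with hρdef
  have hρ0 : ρ ≠ 0 := fun h => by
    rw [h, map_zero, eq_comm, Polynomial.C_eq_zero] at hρ
    exact hc hρ
  let D := Localization.Away ρ
  let BR := Localization.Away (Ideal.Quotient.mk g.I (g.R l))
  have hpow : Submonoid.powers ρ ≤ nonZeroDivisors (Polynomial A) :=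
    powers_le_nonZeroDivisors_of_noZeroDivisors hρ0
  have : IsDomain D := IsLocalization.isDomain_localization hpow
  have hinj : Function.Injective (algebraMap (Polynomial A) D) := IsLocalization.injective D hpow
  let ι : Polynomial A →ₐ[A] D := IsScalarTower.toAlgHom A (Polynomial A) D
  have hX : algebraMap A D Polynomial.X ≠ 0 := by
    rw [IsScalarTower.algebraMap_apply A (Polynomial A) D]
    exact (map_ne_zero_iff _ hinj).2 (by simp)
  have hD := X_mul_eq_zero_of_isDomain hX
  have hyD : IsSolBelow l (fun i => ι (y i)) := fun f hf => by
    rw [aeval_algHom, ← hy.sol f hf, map_mul, AlgHom.commutes]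
  have huD : IsUnit (MvPolynomial.aeval (fun i => ι (y i)) (g.R l)) := by
    rw [aeval_algHom]
    exact IsLocalization.Away.algebraMap_isUnit ρ
  obtain ⟨x, hx, hxy⟩ := hyD.exists_isSol hD hl huD
  let ψ₀ : g.B →ₐ[A] D := lift hD hx
  have hψ₀ : ∀ i ∈ g.below l, ψ₀ (g.gen i) = ι (y i) := fun i hi => by
    rw [← hxy i hi]; exact lift_gen hD hx i
  have hψu : IsUnit (ψ₀ (Ideal.Quotient.mk g.I (g.R l))) := by
    rw [map_mk, aeval_congr_of_mem_supported (R_mem_supported l) hψ₀]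
    exact huD
  let ψ : BR →ₐ[A] D := IsLocalization.liftAlgHom
    (M := Submonoid.powers (Ideal.Quotient.mk g.I (g.R l))) (f := ψ₀) (by
      rintro ⟨_, n, rfl⟩
      rw [map_pow]
      exact hψu.pow n)
  let κ : g.B →ₐ[A] BR := IsScalarTower.toAlgHom A g.B BR
  have hκu : IsUnit (κ (Ideal.Quotient.mk g.I (g.R l))) :=
    IsLocalization.Away.algebraMap_isUnit _
  have hψκ : ∀ b, ψ (κ b) = ψ₀ b := fun b => IsLocalization.lift_eq _ b
  obtain ⟨v, hv⟩ := hy.exists_coord BR (fun i => κ (g.gen i)) ((isSol_gen κ).isSolBelow l)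
    (by rw [← map_mk]; exact hκu)
  let φ₀ : Polynomial A →ₐ[A] BR := Polynomial.aeval v
  have hφu : IsUnit (φ₀ ρ) := by
    have : φ₀ ρ = κ (Ideal.Quotient.mk g.I (g.R l)) := by
      rw [map_mk, aeval_congr_of_mem_supported (R_mem_supported l) hv, aeval_algHom]
    rw [this]
    exact hκu
  let φ : D →ₐ[A] BR := IsLocalization.liftAlgHom (M := Submonoid.powers ρ) (f := φ₀) (by
      rintro ⟨_, n, rfl⟩
      rw [map_pow]
      exact hφu.pow n)
  have hφι : ∀ p, φ (ι p) = φ₀ p := fun p => IsLocalization.lift_eq _ p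
  refine ⟨AlgEquiv.ofAlgHom ψ φ ?_ ?_⟩
  · refine IsLocalization.algHom_ext (Submonoid.powers ρ) ?_
    refine Polynomial.algHom_ext ?_
    change ψ (φ (ι Polynomial.X)) = ι Polynomial.X
    rw [hφι]
    obtain ⟨k, s, hs⟩ := hy.none
    have h1 := hv none (none_mem_below l)
    have h2 := hψ₀ none (none_mem_below l)
    rw [← hψκ, h1, ← Polynomial.aeval_algHom_apply, hs] at h2
    simp only [φ₀, map_add, map_mul, Polynomial.aeval_C, Polynomial.aeval_X] at h2 ⊢
    have h3 : ∀ q : A, ι (Polynomial.C q) = algebraMap A D q := fun q => ι.commutes q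
    rw [h3, h3] at h2
    rw [map_pow] at h2
    exact mul_left_cancel₀ (pow_ne_zero k hX) (add_left_cancel h2)
  · refine IsLocalization.algHom_ext
      (Submonoid.powers (Ideal.Quotient.mk g.I (g.R l))) ?_
    change (φ.comp (ψ.comp κ)) = κ
    have hψκ' : ψ.comp κ = ψ₀ := AlgHom.ext hψκ
    rw [hψκ', eq_comm]
    refine algHom_ext_of_isUnit hl hκu fun i hi => ?_
    rw [AlgHom.comp_apply, hψ₀ i hi, hφι]
    exact hv i hi

/-- The root polynomials of the leaves have no common zero on `V_g`. -/
theorem exists_isMax_R_notMem (hg : g.IsFine) (p : Ideal g.B) [p.IsPrime] :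
    ∃ l : g.Node, IsMax l ∧ Ideal.Quotient.mk g.I (g.R l) ∉ p := by
  classical
  obtain ⟨e, he⟩ := (Set.toFinite {e | Ideal.Quotient.mk g.I (g.R e) ∉ p}).exists_maximal
    ⟨g.root, by
      rw [Set.mem_ofPred_eq, R_root, map_one]
      exact p.one_notMem⟩
  refine ⟨e, ?_, he.prop⟩
  by_contra hmax
  obtain ⟨e', he'⟩ := not_isMax_iff.1 hmax
  -- Two factors of `S_e` differ by a nonzero constant, so at most one lies in `p`. Passing to the
  -- child whose root polynomial omits that factor contradicts the maximality of `e`.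
  have hchild : ∃ f, ∃ _ : f ∈ g.Child e, ∀ f' (hf' : f' ∈ g.Child e), f' ≠ f →
      Ideal.Quotient.mk g.I (factor hf') ∉ p := by
    by_cases h : ∃ f, ∃ hf : f ∈ g.Child e, Ideal.Quotient.mk g.I (factor hf) ∈ p
    · obtain ⟨f, hf, hfp⟩ := h
      refine ⟨f, hf, fun f' hf' hne hfp' => ?_⟩
      have h1 := p.sub_mem hfp hfp'
      rw [← map_sub] at h1
      have h2 : factor hf - factor hf' = algebraMap ℂ g.AΓ
          (g.lb ⟨f', ne_root_of_mem_Child hf'⟩ - g.lb ⟨f, ne_root_of_mem_Child hf⟩) := by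
        rw [map_sub]
        simp only [factor, label]
        change _ = MvPolynomial.C (Polynomial.C _) - MvPolynomial.C (Polynomial.C _)
        ring
      rw [h2] at h1
      refine ‹p.IsPrime›.ne_top (p.eq_top_of_isUnit_mem h1 ?_)
      refine ((IsUnit.mk0 _ (sub_ne_zero.2 (hg _ _ ?_ ?_))).map _).map _
      · exact fun h => hne (Subtype.ext_iff.1 h)
      · rw [par_eq_of_mem_Child hf', par_eq_of_mem_Child hf]
    · exact ⟨_, childToward_mem he', fun f' hf' _ hfp' => h ⟨f', hf', hfp'⟩⟩
  obtain ⟨f, hf, hfp⟩ := hchild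
  refine (lt_of_mem_Child hf).not_ge (he.le_of_ge ?_ (lt_of_mem_Child hf).le)
  rw [Set.mem_ofPred_eq, R_eq_of_mem_Child hf, map_mul]
  refine ‹p.IsPrime›.mul_notMem ?_ he.prop
  intro hS
  obtain ⟨f', hf', hp⟩ := (Ideal.IsPrime.prod_mem_iff (p := p.comap (Ideal.Quotient.mk g.I))).1 hS
  exact hfp f'.1 f'.2 (by simpa using hf') hp

end LabelledRootedTree

/-! ### Regularity, dimension and annihilators under localization -/

section Localization

variable {R : Type*} [CommRing R]

theorem isRegularRing_localization [IsRegularRing R] (M : Submonoid R) :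
    IsRegularRing (Localization M) := by
  have : IsNoetherianRing (Localization M) :=
    IsLocalization.isNoetherianRing M _ inferInstance
  refine isRegularRing_iff.2 fun p _ => ?_
  have := isRegularRing_iff.1 ‹IsRegularRing R› (p.comap (algebraMap R (Localization M)))
  exact IsRegularLocalRing.of_ringEquiv
    (IsLocalization.localizationLocalizationAtPrimeIsoLocalization M p).toRingEquiv

theorem isRegularLocalRing_of_isRegularRing_localization {M : Submonoid R} (p : Ideal R)
    [p.IsPrime] (h : Disjoint (M : Set R) (p : Set R)) [IsRegularRing (Localization M)] :
    IsRegularLocalRing (Localization.AtPrime p) := by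
  set P := p.map (algebraMap R (Localization M)) with hP
  have hPp : P.IsPrime := IsLocalization.isPrime_of_isPrime_disjoint M _ p ‹_› h
  have := isRegularRing_iff.1 ‹IsRegularRing (Localization M)› P
  have hloc := IsLocalization.isLocalization_isLocalization_atPrime_isLocalization (M := M)
    (Localization.AtPrime P) P
  have hcomap : P.comap (algebraMap R (Localization M)) = p :=
    IsLocalization.under_map_of_isPrime_disjoint M _ ‹_› h
  simp_rw [hcomap] at hloc
  exact IsRegularLocalRing.of_ringEquiv (IsLocalization.algEquiv p.primeCompl
    (Localization.AtPrime P) (Localization.AtPrime p)).toRingEquiv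

theorem ringKrullDim_localization_le (M : Submonoid R) :
    ringKrullDim (Localization M) ≤ ringKrullDim R := by
  refine (ringKrullDim_le_iff_height_le _).2 fun p hp => ?_
  rw [← IsLocalization.height_under M p]
  have := hp.comap (algebraMap R (Localization M))
  exact Ideal.height_le_ringKrullDim_of_isPrime

theorem height_le_ringKrullDim_localization {M : Submonoid R} (p : Ideal R) [p.IsPrime]
    (h : Disjoint (M : Set R) (p : Set R)) : p.height ≤ ringKrullDim (Localization M) := by
  rw [← IsLocalization.height_map_of_disjoint (S := Localization M) M p h]
  have := IsLocalization.isPrime_of_isPrime_disjoint M (Localization M) p ‹_› h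
  exact Ideal.height_le_ringKrullDim_of_isPrime

theorem disjoint_powers_of_notMem {p : Ideal R} [p.IsPrime] {f : R} (hf : f ∉ p) :
    Disjoint (Submonoid.powers f : Set R) (p : Set R) :=
  (Ideal.disjoint_powers_iff_notMem f (Ideal.IsPrime.isRadical ‹_›)).2 hf

/-- Take a maximal ideal containing the annihilator of `b`: if `b` dies after inverting `f`, a power
of `f` lies in that annihilator. -/
theorem exists_isPrime_algebraMap_away_ne_zero {b : R} (hb : b ≠ 0) :
    ∃ p : Ideal R, p.IsPrime ∧ ∀ f ∉ p, algebraMap R (Localization.Away f) b ≠ 0 := by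
  have hne : Ideal.torsionOf R R b ≠ ⊤ := fun h => hb (by
    have : (1 : R) ∈ Ideal.torsionOf R R b := h ▸ trivial
    simpa using this)
  obtain ⟨m, hm, hle⟩ := Ideal.exists_le_maximal _ hne
  refine ⟨m, hm.isPrime, fun f hf h0 => ?_⟩
  obtain ⟨⟨_, n, rfl⟩, hn⟩ := (IsLocalization.map_eq_zero_iff (Submonoid.powers f) _ _).1 h0
  exact hf (hm.isPrime.mem_of_pow_mem n (hle (by simpa using hn)))

theorem isNonsingular_Spec (R : CommRingCat) [IsRegularRing R] : IsNonsingular (Spec R) := by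
  refine ⟨inferInstance, fun x => ?_⟩
  let _ : Algebra R ((Spec R).presheaf.stalk x) := StructureSheaf.stalkAlgebra R x
  have hx : x.asIdeal.IsPrime := x.isPrime
  have : IsLocalization.AtPrime ((Spec R).presheaf.stalk x) x.asIdeal :=
    StructureSheaf.IsLocalization.to_stalk R x
  exact IsRegularLocalRing.of_ringEquiv (IsLocalization.algEquiv x.asIdeal.primeCompl
    (Localization.AtPrime x.asIdeal) ((Spec R).presheaf.stalk x)).toRingEquiv

end Localization

theorem ringKrullDim_polynomial_A : ringKrullDim (Polynomial A) = 2 := by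
  rw [Polynomial.ringKrullDim_of_isNoetherianRing,
    IsPrincipalIdealRing.ringKrullDim_eq_one A (Polynomial.not_isField ℂ)]
  norm_num

namespace LabelledRootedTree

open FinRootedTree

theorem ringKrullDim_localization_polynomial_A {ρ : Polynomial A} {c : ℂ} (hc : c ≠ 0)
    (hρ : modH ρ = Polynomial.C c) : ringKrullDim (Localization.Away ρ) = 2 := by
  refine le_antisymm ((ringKrullDim_localization_le _).trans ringKrullDim_polynomial_A.le) ?_
  -- The chain `0 < (h) < (h, u)` survives inverting `ρ`, because `ρ` takes the value `c ≠ 0` at the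
  -- origin.
  let ε : Polynomial A →+* ℂ := (Polynomial.evalRingHom 0).comp modH
  have h1 : (RingHom.ker modH).IsPrime := RingHom.ker_isPrime _
  have h2 : (RingHom.ker ε).IsPrime := RingHom.ker_isPrime _
  have hlt1 : (⊥ : Ideal (Polynomial A)) < RingHom.ker modH := by
    refine bot_lt_iff_ne_bot.2 fun h => ?_
    have : Polynomial.C (Polynomial.X : A) ∈ RingHom.ker modH := by simp [RingHom.mem_ker]
    rw [h, Ideal.mem_bot] at this
    simp at this
  have hlt2 : RingHom.ker modH < RingHom.ker ε := by
    refine lt_of_le_of_ne (fun p hp => ?_) fun h => ?_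
    · rw [RingHom.mem_ker] at hp ⊢
      simp [ε, hp]
    · have : (Polynomial.X : Polynomial A) ∈ RingHom.ker ε := by simp [RingHom.mem_ker, ε]
      rw [← h, RingHom.mem_ker] at this
      simp at this
  have hheight : 2 ≤ (RingHom.ker ε).height := by
    have h3 := Ideal.height_add_one_le_of_lt_of_isPrime hlt1
    have h4 := Ideal.height_add_one_le_of_lt_of_isPrime hlt2
    calc (2 : ℕ∞) = 0 + 1 + 1 := by norm_num
      _ ≤ (RingHom.ker modH).height + 1 := by gcongr; exact le_trans (by gcongr; simp) h3
      _ ≤ _ := h4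
  have hmem : ρ ∉ RingHom.ker ε := by simp [RingHom.mem_ker, ε, hρ, hc]
  refine le_trans ?_ (height_le_ringKrullDim_localization _ (disjoint_powers_of_notMem hmem))
  exact WithBot.coe_le_coe.2 hheight

/-! ### Global properties of `B_g` -/

variable {g : LabelledRootedTree}

instance : Algebra.FinitePresentation A g.B :=
  (Algebra.FinitePresentation.of_finiteType (R := A) (A := g.B)).1 inferInstance

theorem formallySmooth (hg : g.IsFine) : Algebra.FormallySmooth A g.B := by
  rw [← Algebra.smoothLocus_eq_univ_iff, Set.eq_univ_iff_forall]
  intro p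
  obtain ⟨l, hl, hp⟩ := exists_isMax_R_notMem hg p.asIdeal
  obtain ⟨ρ, c, -, -, ⟨E⟩⟩ := exists_localization_equiv hg hl
  refine Algebra.basicOpen_subset_smoothLocus_iff.2 ?_ hp
  have : Algebra.FormallySmooth (Polynomial A) (Localization.Away ρ) := inferInstance
  have : Algebra.FormallySmooth A (Localization.Away ρ) :=
    Algebra.FormallySmooth.comp A (Polynomial A) _
  exact Algebra.FormallySmooth.of_equiv E.symm

/-- Being `h`-torsion free is local, and each leaf localization is a domain in which `h` is nonzero.
-/
theorem X_mul_eq_zero (hg : g.IsFine) (b : g.B) (hb : algebraMap A g.B Polynomial.X * b = 0) :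
    b = 0 := by
  by_contra hb0
  obtain ⟨m, hm, hmb⟩ := exists_isPrime_algebraMap_away_ne_zero (R := g.B) hb0
  obtain ⟨l, hl, hlm⟩ := exists_isMax_R_notMem hg m
  obtain ⟨ρ, c, hc, hρ, ⟨E⟩⟩ := exists_localization_equiv hg hl
  have hρ0 : ρ ≠ 0 := fun h => by
    rw [h, map_zero, eq_comm, Polynomial.C_eq_zero] at hρ
    exact hc hρ
  have hpow : Submonoid.powers ρ ≤ nonZeroDivisors (Polynomial A) :=
    powers_le_nonZeroDivisors_of_noZeroDivisors hρ0
  have : IsDomain (Localization.Away ρ) := IsLocalization.isDomain_localization hpow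
  have hX : algebraMap A (Localization.Away ρ) Polynomial.X ≠ 0 := by
    rw [IsScalarTower.algebraMap_apply A (Polynomial A) (Localization.Away ρ)]
    exact (map_ne_zero_iff _ (IsLocalization.injective _ hpow)).2 (by simp)
  refine hmb _ hlm ((map_eq_zero_iff E E.injective).1 (X_mul_eq_zero_of_isDomain hX _ ?_))
  rw [← E.commutes, ← map_mul, IsScalarTower.algebraMap_apply A g.B, ← map_mul, hb, map_zero,
    map_zero]

/-- After multiplication by a power of `h`, every element of `B_g` is a polynomial in `X₀`. -/
theorem exists_X_pow_mul_eq (b : g.B) : ∃ (n : ℕ) (p : Polynomial A),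
    algebraMap A g.B Polynomial.X ^ n * b = Polynomial.aeval (g.gen none) p := by
  let T : Subalgebra A g.B :=
    { carrier := {b | ∃ (n : ℕ) (p : Polynomial A),
        algebraMap A g.B Polynomial.X ^ n * b = Polynomial.aeval (g.gen none) p}
      mul_mem' := by
        rintro b b' ⟨n, p, hp⟩ ⟨n', p', hp'⟩
        exact ⟨n + n', p * p', by rw [map_mul, ← hp, ← hp']; ring⟩
      add_mem' := by
        rintro b b' ⟨n, p, hp⟩ ⟨n', p', hp'⟩
        refine ⟨n + n', Polynomial.C (Polynomial.X ^ n') * p +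
          Polynomial.C (Polynomial.X ^ n) * p', ?_⟩
        rw [map_add, map_mul, map_mul, ← hp, ← hp', Polynomial.aeval_C, Polynomial.aeval_C,
          map_pow, map_pow]
        ring
      algebraMap_mem' := fun a => ⟨0, Polynomial.C a, by simp⟩ }
  have hgen : ∀ i, g.gen i ∈ T := by
    have hnone : g.gen none ∈ T := ⟨0, Polynomial.X, by simp⟩
    rintro (_ | e)
    · exact hnone
    induction e using WellFoundedLT.induction with
    | ind e ih =>
      have h1 : MvPolynomial.aeval g.gen (g.Q e.1) ∈ T :=
        aeval_mem_of_mem_supported (C := g.B) (x := g.gen) (Q_mem_supported e.1) fun i hi => by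
          rcases i with _ | f
          · exact hnone
          · exact ih f (some_mem_below.1 hi)
      have h2 : algebraMap A g.B Polynomial.X * g.gen (some e) =
        MvPolynomial.aeval g.gen (g.Q e.1) := isSol_gen (C := g.B) (AlgHom.id A g.B) e
      rw [← h2] at h1
      obtain ⟨n, p, hp⟩ := h1
      exact ⟨n + 1, p, by rw [← hp]; ring⟩
  obtain ⟨p, rfl⟩ := Ideal.Quotient.mk_surjective b
  have h1 : Ideal.Quotient.mk g.I p = MvPolynomial.aeval g.gen p :=
    map_mk (C := g.B) (AlgHom.id A g.B) p
  rw [h1]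
  have hp : p ∈ MvPolynomial.supported A Set.univ := by simp [MvPolynomial.supported_univ]
  exact aeval_mem_of_mem_supported (C := g.B) (x := g.gen) (T := T) hp fun i _ => hgen i

/-- In the fraction field `K`, `h` is invertible, so the relations are solvable with `X₀ = u`. If
`b` maps to 0 and `h^n b = p(X₀)`, then `p(u) = 0`, hence `p = 0` and `h^n b = 0`; cancelling `h`
gives `b = 0`. -/
theorem isDomain_B (hg : g.IsFine) : IsDomain g.B := by
  let K := FractionRing (Polynomial A)
  have hinj : Function.Injective (algebraMap (Polynomial A) K) := IsFractionRing.injective _ _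
  have hX : algebraMap A K Polynomial.X ≠ 0 := by
    rw [IsScalarTower.algebraMap_apply A (Polynomial A) K]
    exact (map_ne_zero_iff _ hinj).2 (by simp)
  obtain ⟨x, hx, hx0⟩ := exists_isSol (g := g) (algebraMap (Polynomial A) K Polynomial.X)
    fun e x _ _ => ⟨_, mul_div_cancel₀ (MvPolynomial.aeval x (g.Q e.1)) hX⟩
  let χ : g.B →ₐ[A] K := lift (X_mul_eq_zero_of_isDomain hX) hx
  have hχ : Function.Injective χ := by
    refine (injective_iff_map_eq_zero χ).2 fun b hb => ?_
    obtain ⟨n, p, hp⟩ := exists_X_pow_mul_eq b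
    have h1 := congrArg χ hp
    rw [map_mul, hb, mul_zero, ← Polynomial.aeval_algHom_apply, lift_gen, hx0,
      Polynomial.aeval_algebraMap_apply, Polynomial.aeval_X_left_apply, eq_comm,
      map_eq_zero_iff _ hinj] at h1
    rw [h1, map_zero] at hp
    clear h1
    induction n with
    | zero => simpa using hp
    | succ n ih => exact ih (X_mul_eq_zero hg _ (by rw [← hp]; ring))
  exact hχ.isDomain χ.toRingHom

theorem isRegularRing_B (hg : g.IsFine) : IsRegularRing g.B := by
  refine isRegularRing_iff.2 fun p _ => ?_
  obtain ⟨l, hl, hp⟩ := exists_isMax_R_notMem hg p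
  obtain ⟨ρ, c, -, -, ⟨E⟩⟩ := exists_localization_equiv hg hl
  have := isRegularRing_localization (Submonoid.powers ρ)
  have : IsRegularRing (Localization.Away (Ideal.Quotient.mk g.I (g.R l))) :=
    IsRegularRing.of_ringEquiv E.symm.toRingEquiv
  exact isRegularLocalRing_of_isRegularRing_localization p (disjoint_powers_of_notMem hp)

theorem ringKrullDim_B (hg : g.IsFine) : ringKrullDim g.B = 2 := by
  have hdim : ∀ l : g.Node, IsMax l →
      ringKrullDim (Localization.Away (Ideal.Quotient.mk g.I (g.R l))) = 2 := fun l hl => by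
    obtain ⟨ρ, c, hc, hρ, ⟨E⟩⟩ := exists_localization_equiv hg hl
    rw [ringKrullDim_eq_of_ringEquiv E.toRingEquiv, ringKrullDim_localization_polynomial_A hc hρ]
  refine le_antisymm ((ringKrullDim_le_iff_height_le (R := g.B) _).2 fun p hp => ?_) ?_
  · obtain ⟨l, hl, hlp⟩ := exists_isMax_R_notMem hg p
    rw [← hdim l hl]
    exact height_le_ringKrullDim_localization p (disjoint_powers_of_notMem hlp)
  -- For the lower bound a single leaf suffices; the prime ideal 0 supplies one.
  · have := isDomain_B hg
    obtain ⟨l, hl, -⟩ := exists_isMax_R_notMem hg (⊥ : Ideal g.B)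
    rw [← hdim l hl]
    exact ringKrullDim_localization_le _

end LabelledRootedTree

end Danielewski

end

open Danielewski.LabelledRootedTree in
theorem mainTheorem10 (g : Danielewski.LabelledRootedTree) (hg : g.IsFine) :
    AlgebraicGeometry.Smooth g.q ∧ Danielewski.IsSurface g.V ∧ Danielewski.IsNonsingular g.V := by
  have hdom := isDomain_B hg
  have hreg := isRegularRing_B hg
  refine ⟨?_, ⟨?_, ?_⟩, Danielewski.isNonsingular_Spec (CommRingCat.of g.B)⟩
  · have := formallySmooth hg
    have : Algebra.Smooth Danielewski.A g.B := {}
    refine (HasRingHomProperty.Spec_iff (P := @AlgebraicGeometry.Smooth)).2 ?_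
    exact RingHom.smooth_algebraMap.2 this
  · exact inferInstanceAs (AlgebraicGeometry.IsIntegral (Spec (CommRingCat.of g.B)))
  · exact (PrimeSpectrum.topologicalKrullDim_eq_ringKrullDim (R := g.B)).trans (ringKrullDim_B hg)
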